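/- Let $\Gamma$ be a finite simple graph with vertex set $V(\Gamma)$ and edge set $E(\Gamma)$, and let $$G(\Gamma)=\langle\, v\in V(\Gamma)\mid uv=vu \text{ if } \{u,v\}\notin E(\Gamma)\,\rangle$$ be the right-angled Artin group in which two distinct generators commute when they are \emph{not} adjacent. For $g\in G(\Gamma)$ let $|g|$ be the word length of $g$ with respect to $V(\Gamma)^{\pm1}$; a word representing $g$ is reduced if its length is $|g|$; and the support $\mathrm{supp}(g)$ is the set of all $v\in V(\Gamma)$ such that $v$ or $v^{-1}$ appears in a reduced word representing $g$. Elements $g,g'$ disjointly commute if $\mathrm{supp}(g)\cap\mathrm{supp}(g')=\emptyset$ and no vertex of $\mathrm{supp}(g)$ is adjacent to a vertex of $\mathrm{supp}(g')$. An element $g$ is strongly non-split if $\mathrm{supp}(g)$ spans a connected subgraph of $\Gamma$ and no generator $v\in V(\Gamma)$ disjointly commutes with $g$. An element $g\neq 1$ is primitive if there are no $u\in G(\Gamma)$ and $n\ge 2$ with $g=u^n$. A decomposition $g=g_1\cdots g_k$ is geodesic if $|g|=|g_1|+\cdots+|g_k|$; a decomposition $h=ag^nb$ is called geodesic if $h=a\cdot\underbrace{g\cdots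 g}_{n}\cdot b$ is geodesic, i.e. $|h|=|a|+n|g|+|b|$. \textbf{Proposition.} Let $\Gamma$ be a finite connected simple graph, and let $$h=a_1g_1^{n_1}b_1=a_2g_2^{n_2}b_2$$ be two geodesic decompositions of $h\in G(\Gamma)$, where $n_i\ge 1$ and $a_i,b_i,g_i\in G(\Gamma)$ for $i=1,2$. Suppose that $g_1$ and $g_2$ are strongly non-split and primitive and that there exist real constants $A,B\ge 0$ such that $$|a_i|\le A,\qquad |b_i|\le B,\qquad |h|-(A+B)\ge (2|V(\Gamma)|+1)\,|g_i|\qquad\text{for } i=1,2.$$ Then $g_1$ and $g_2$ are conjugate in $G(\Gamma)$, and moreover $$a_1g_1a_1^{-1}=a_2g_2a_2^{-1}\qquad\text{and}\qquad b_1^{-1}g_1b_1=b_2^{-1}g_2b_2.$$ -/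

import Mathlib

namespace RAAG

variable {V : Type*}

/-- The right-angled Artin group `G(Γ)`, in the convention in which two generators commute if and
only if they are *not* joined by an edge:
`G(Γ) = ⟨ v ∈ V | [u, v] = 1 if {u, v} is not an edge of Γ ⟩`. -/
abbrev Grp (Γ : SimpleGraph V) : Type _ :=
  PresentedGroup
    {r : FreeGroup V | ∃ u v : V, ¬ Γ.Adj u v ∧
      r = FreeGroup.of u * FreeGroup.of v * (FreeGroup.of u)⁻¹ * (FreeGroup.of v)⁻¹}

/-- The generator of `G(Γ)` given by a vertex. -/
def gen (Γ : SimpleGraph V) (v : V) : Grp Γ := PresentedGroup.of v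

/-- The element of `G(Γ)` represented by a word; the letter `(v, true)` stands for `v` and
`(v, false)` for `v⁻¹`. -/
def ofWord (Γ : SimpleGraph V) (w : List (V × Bool)) : Grp Γ :=
  PresentedGroup.mk _ (FreeGroup.mk w)

variable {Γ : SimpleGraph V}

/-- A word is reduced if it is a shortest word among all words representing the same element. -/
def IsReducedWord (Γ : SimpleGraph V) (w : List (V × Bool)) : Prop :=
  ∀ w' : List (V × Bool), ofWord Γ w' = ofWord Γ w → w.length ≤ w'.length

/-- The word length `|g|`: the least length of a word representing `g`. -/
noncomputable def wordLength (g : Grp Γ) : ℕ :=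
  sInf {n : ℕ | ∃ w : List (V × Bool), ofWord Γ w = g ∧ w.length = n}

/-- The support of `g`: the vertices `v` such that `v` or `v⁻¹` appears in a reduced word
representing `g`. -/
def supp (g : Grp Γ) : Set V :=
  {v | ∃ w : List (V × Bool), IsReducedWord Γ w ∧ ofWord Γ w = g ∧ ∃ ε : Bool, (v, ε) ∈ w}

/-- `g₁` and `g₂` disjointly commute: their supports are disjoint and each generator in the first
support commutes with (that is, is not adjacent to) each generator in the second. -/
def DisjointlyCommute (g₁ g₂ : Grp Γ) : Prop :=
  Disjoint (supp g₁) (supp g₂) ∧ ∀ v₁ ∈ supp g₁, ∀ v₂ ∈ supp g₂, ¬ Γ.Adj v₁ v₂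

/-- `g` is non-split if its support spans a connected subgraph of `Γ`. -/
def NonSplit (g : Grp Γ) : Prop := (Γ.induce (supp g)).Connected

/-- `g` is strongly non-split if it is non-split and no generator disjointly commutes with it. -/
def StronglyNonSplit (g : Grp Γ) : Prop :=
  NonSplit g ∧ ¬ ∃ v : V, DisjointlyCommute (gen Γ v) g

/-- `g` is primitive if it is nontrivial and not a nontrivial power of another element. -/
def IsPrimitive (g : Grp Γ) : Prop :=
  g ≠ 1 ∧ ¬ ∃ (u : Grp Γ) (n : ℕ), 2 ≤ n ∧ g = u ^ n

/-- `g = g₁ ⋯ g_k` is a geodesic decomposition, where `l = [g₁, …, g_k]`: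
`|g| = |g₁| + ⋯ + |g_k|`. -/
def IsGeodesicDecomposition (g : Grp Γ) (l : List (Grp Γ)) : Prop :=
  g = l.prod ∧ wordLength g = (l.map wordLength).sum

/-- `h = a gⁿ b` is a geodesic decomposition, `gⁿ` being read as the product of `n` factors `g`:
`h = a · g · g ⋯ g · b` and `|h| = |a| + n |g| + |b|`. -/
def IsGeodesicPowerDecomposition (h a g : Grp Γ) (n : ℕ) (b : Grp Γ) : Prop :=
  IsGeodesicDecomposition h ([a] ++ List.replicate n g ++ [b])

end RAAG

/-! Record a word by its projections: for each pair of equal or adjacent vertices, the subword of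
letters over that pair. Projections determine the group element (`ofWord_eq_of_proj_eq`), and
reduced words for one element have equal projections (`IsReducedWord.proj_eq`), because the group
acts on the projection families of words without cancellation. So the two geodesic decompositions of
`h` become, in every projection, two factorizations of one ordinary word around periodic runs.

Strong non-splitness carries the length bounds over to projections: an excess of a prefix at one
vertex spreads over the support, losing at most one block per edge (`cnt_le_of_length_lt`). The
constant `2|V| + 1` pays for this at both ends and leaves three blocks (`max_add_max_add_le`), so
the runs overlap in at least the sum of the periods. A Fine–Wilf argument makes the projected
periods powers of conjugate words (`Overlap.exists_wpow`).

Connectivity then gives the letter counts of `g₁` and `g₂` one common ratio `s : t` in lowest terms.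
Every projection of `g₁` is an `s`-th power, the roots glue to a root of `g₁`, and primitivity
forces `s = 1`; likewise `t = 1` (`cnt_eq_of_overlap`). Once the periods have equal length, one more
block fits into both runs (`Overlap.wpow_succ_eq`), so `a₁ g₁^(n₁+1) b₁ = a₂ g₂^(n₂+1) b₂`.
Cancelling `h` on the right or on the left yields the two identities. -/

namespace RAAG

/-! ### Combinatorics of words -/

variable {α : Type*}

/-- The `n`-th power of a word. -/
def wpow (w : List α) : ℕ → List α
  | 0 => []
  | n + 1 => w ++ wpow w n

@[simp] theorem wpow_zero (w : List α) : wpow w 0 = [] := rfl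

theorem wpow_succ (w : List α) (n : ℕ) : wpow w (n + 1) = w ++ wpow w n := rfl

@[simp] theorem wpow_one (w : List α) : wpow w 1 = w := by simp [wpow_succ]

theorem wpow_add (w : List α) (m n : ℕ) : wpow w (m + n) = wpow w m ++ wpow w n := by
  induction m with
  | zero => simp
  | succ m ih => rw [Nat.add_right_comm, wpow_succ, ih, wpow_succ, List.append_assoc]

theorem wpow_succ' (w : List α) (n : ℕ) : wpow w (n + 1) = wpow w n ++ w := by
  rw [wpow_add, wpow_one]

theorem wpow_mul (w : List α) (m n : ℕ) : wpow w (m * n) = wpow (wpow w m) n := by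
  induction n with
  | zero => simp
  | succ n ih => rw [Nat.mul_succ, wpow_add, ih, wpow_succ']

@[simp] theorem wpow_nil (n : ℕ) : wpow ([] : List α) n = [] := by
  induction n with
  | zero => rfl
  | succ n ih => simp [wpow_succ, ih]

@[simp] theorem length_wpow (w : List α) (n : ℕ) : (wpow w n).length = n * w.length := by
  induction n with
  | zero => simp
  | succ n ih => rw [wpow_succ, List.length_append, ih]; ring

@[simp] theorem countP_wpow (q : α → Bool) (w : List α) (n : ℕ) :
    (wpow w n).countP q = n * w.countP q := by
  induction n with
  | zero => simp
  | succ n ih => rw [wpow_succ, List.countP_append, ih]; ring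

theorem filter_wpow (q : α → Bool) (w : List α) (n : ℕ) :
    (wpow w n).filter q = wpow (w.filter q) n := by
  induction n with
  | zero => simp
  | succ n ih => rw [wpow_succ, List.filter_append, ih, wpow_succ]

theorem reverse_wpow (w : List α) (n : ℕ) : (wpow w n).reverse = wpow w.reverse n := by
  induction n with
  | zero => simp
  | succ n ih => rw [wpow_succ, List.reverse_append, ih, wpow_succ']

theorem wpow_prefix_wpow (w : List α) {m n : ℕ} (h : m ≤ n) : wpow w m <+: wpow w n := by
  obtain ⟨k, rfl⟩ := Nat.exists_eq_add_of_le h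
  rw [wpow_add]
  exact List.prefix_append _ _

/-- Commuting words are powers of a common word. -/
theorem exists_wpow_of_append_comm (x y : List α) (h : x ++ y = y ++ x) :
    ∃ z k l, x = wpow z k ∧ y = wpow z l := by
  induction hn : x.length + y.length using Nat.strong_induction_on generalizing x y with
  | _ n ih =>
    subst hn
    wlog hle : x.length ≤ y.length generalizing x y
    · obtain ⟨z, k, l, h1, h2⟩ := this y x h.symm
        (fun m hm a b hab hl => ih m (by omega) a b hab hl) (by omega)
      exact ⟨z, l, k, h2, h1⟩
    rcases x.eq_nil_or_concat with rfl | hx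
    · exact ⟨y, 0, 1, rfl, by simp⟩
    have hpos : 0 < x.length := by
      obtain ⟨_, _, rfl⟩ := hx
      simp
    obtain ⟨y', rfl⟩ : x <+: y :=
      List.prefix_of_prefix_length_le (List.prefix_append x y) (h ▸ List.prefix_append y x) hle
    have h' : x ++ y' = y' ++ x := by
      rw [List.append_assoc] at h
      exact List.append_cancel_left h
    obtain ⟨z, k, l, h1, h2⟩ := ih (x.length + y'.length)
      (by simp only [List.length_append]; omega) x y' h' rfl
    exact ⟨z, k, k + l, h1, by rw [wpow_add, ← h1, ← h2]⟩

/-- A conjugate of a power is a power of a conjugate. -/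
theorem exists_wpow_of_append_eq {g z : List α} {s : ℕ} (c : List α)
    (h : g ++ c = c ++ wpow z s) : ∃ w, g = wpow w s ∧ w.Perm z := by
  induction c generalizing g with
  | nil => exact ⟨z, by simpa using h, .refl _⟩
  | cons a c ih =>
    rcases g with _ | ⟨b, g⟩
    · have hl := congrArg List.length h
      simp only [List.nil_append, List.length_append, length_wpow] at hl
      have hz : s * z.length = 0 := by omega
      rcases Nat.mul_eq_zero.1 hz with rfl | hz
      · exact ⟨z, rfl, .refl _⟩
      · rw [List.length_eq_zero_iff] at hz
        subst hz
        exact ⟨[], by simp, .refl _⟩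
    · simp only [List.cons_append, List.cons.injEq] at h
      obtain ⟨rfl, h⟩ := h
      -- Conjugation by one letter rotates `b :: g` to `g ++ [b]`. The root of the rotated word ends
      -- in `b`; rotating it back gives the root sought.
      obtain ⟨w, hw, hp⟩ := ih (g := g ++ [b]) (by simpa using h)
      rcases w.eq_nil_or_concat with rfl | ⟨w', a, rfl⟩
      · simp at hw
      rw [List.concat_eq_append] at hw hp
      have hs : s ≠ 0 := by
        rintro rfl
        simp at hw
      obtain ⟨k, rfl⟩ := Nat.exists_eq_succ_of_ne_zero hs
      have hw2 := hw
      rw [Nat.succ_eq_add_one, wpow_succ', ← List.append_assoc] at hw2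
      obtain ⟨hg, hb⟩ := List.append_inj' hw2 rfl
      simp only [List.cons.injEq, and_true] at hb
      subst hb
      have key : ∀ n, b :: (wpow (w' ++ [b]) n) = wpow (b :: w') n ++ [b] := by
        intro n
        induction n with
        | zero => rfl
        | succ n ihn =>
          rw [wpow_succ, wpow_succ, List.append_assoc, List.append_assoc, ← ihn]
          simp
      refine ⟨b :: w', ?_, ?_⟩
      · rw [hg, ← List.cons_append, key, Nat.succ_eq_add_one, wpow_succ', List.append_assoc]
        rfl
      · refine List.Perm.trans ?_ hp
        exact (List.perm_append_singleton b w').symm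

/-- Two powers with a long common prefix have commuting roots. -/
theorem append_comm_of_prefix {x y T : List α} {m n : ℕ} (hx : T <+: wpow x m)
    (hy : T <+: wpow y n) (hl : T.length = x.length + y.length) : x ++ y = y ++ x := by
  -- After stripping `x` from `T`, the rest is again a prefix of `T` by periodicity, and has the
  -- length of the prefix `y`. Exchanging `x` and `y` gives the other order.
  have aux : ∀ {x y T : List α} {m n : ℕ}, T <+: wpow x m → T <+: wpow y n →
      T.length = x.length + y.length → T = x ++ y := by
    intro x y T m n hx hy hl
    rcases m with _ | m
    · have : T = [] := by simpa using hx
      subst this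
      have : x = [] ∧ y = [] := by
        constructor <;> apply List.length_eq_zero_iff.1 <;> simp at hl <;> omega
      simp [this]
    rcases n with _ | n
    · have : T = [] := by simpa using hy
      subst this
      have : x = [] ∧ y = [] := by
        constructor <;> apply List.length_eq_zero_iff.1 <;> simp at hl <;> omega
      simp [this]
    obtain ⟨T', rfl⟩ : x <+: T :=
      List.prefix_of_prefix_length_le (wpow_succ x m ▸ List.prefix_append _ _) hx (by omega)
    have hT' : T' <+: wpow x (m + 1) := by
      rw [wpow_succ, List.prefix_append_right_inj] at hx
      exact hx.trans (wpow_prefix_wpow x (by omega))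
    have hl' : T'.length = y.length := by simpa using hl
    have hyT : y <+: x ++ T' :=
      List.prefix_of_prefix_length_le (wpow_succ y n ▸ List.prefix_append _ _) hy (by omega)
    have hT'T : T' <+: x ++ T' :=
      List.prefix_of_prefix_length_le hT' (hx) (by simp)
    have := List.prefix_of_prefix_length_le hT'T hyT (by omega)
    rw [this.eq_of_length hl']
  rw [← aux hx hy hl]
  exact aux hy hx (by omega)

/-- The conjugate of `g` by a prefix of one of its powers. -/
theorem exists_append_eq_of_prefix {g c : List α} {n : ℕ} (h : c <+: wpow g n) :
    ∃ x, g ++ c = c ++ x ∧ x.length = g.length := by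
  have h1 : c <+: wpow g (n + 1) := h.trans (wpow_prefix_wpow g (by omega))
  have h2 : g ++ c <+: wpow g (n + 1) := by
    rw [wpow_succ, List.prefix_append_right_inj]
    exact h
  obtain ⟨x, hx⟩ := List.prefix_of_prefix_length_le h1 h2 (by simp)
  refine ⟨x, hx.symm, ?_⟩
  have := congrArg List.length hx
  simp at this
  omega

theorem wpow_append_eq {g c x : List α} (h : g ++ c = c ++ x) (n : ℕ) :
    wpow g n ++ c = c ++ wpow x n := by
  induction n with
  | zero => simp
  | succ n ih => rw [wpow_succ, List.append_assoc, ih, ← List.append_assoc, h, wpow_succ,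
      List.append_assoc]

/-! ### Overlapping periodic runs (Fine–Wilf) -/

/-- Two runs `g₁ ^ n₁` and `g₂ ^ n₂` in the same word overlap in length at least
`|g₁| + |g₂|`. -/
structure Overlap (a₁ g₁ b₁ a₂ g₂ b₂ : List α) (n₁ n₂ : ℕ) : Prop where
  eq : a₁ ++ wpow g₁ n₁ ++ b₁ = a₂ ++ wpow g₂ n₂ ++ b₂
  left : a₂.length + g₁.length + g₂.length ≤ a₁.length + n₁ * g₁.length
  right : a₁.length + g₂.length + g₁.length ≤ a₂.length + n₂ * g₂.length
  run_left : g₂.length + g₁.length ≤ n₁ * g₁.length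
  run_right : g₁.length + g₂.length ≤ n₂ * g₂.length

theorem Overlap.symm {a₁ g₁ b₁ a₂ g₂ b₂ : List α} {n₁ n₂ : ℕ}
    (h : Overlap a₁ g₁ b₁ a₂ g₂ b₂ n₁ n₂) : Overlap a₂ g₂ b₂ a₁ g₁ b₁ n₂ n₁ :=
  ⟨h.eq.symm, h.right, h.left, h.run_right, h.run_left⟩

/-- The periods of overlapping runs are powers of conjugate words. -/
theorem Overlap.exists_wpow {a₁ g₁ b₁ a₂ g₂ b₂ : List α} {n₁ n₂ : ℕ}
    (h : Overlap a₁ g₁ b₁ a₂ g₂ b₂ n₁ n₂) :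
    ∃ w₁ w₂ k l, g₁ = wpow w₁ k ∧ g₂ = wpow w₂ l ∧ w₁.Perm w₂ := by
  wlog hle : a₁.length ≤ a₂.length generalizing a₁ g₁ b₁ a₂ g₂ b₂ n₁ n₂
  · obtain ⟨w₁, w₂, k, l, h1, h2, hp⟩ := this h.symm (by omega)
    exact ⟨w₂, w₁, l, k, h2, h1, hp.symm⟩
  obtain ⟨heq, hl, -, -, hr⟩ := h
  rw [List.append_assoc, List.append_assoc] at heq
  obtain ⟨c, rfl⟩ : a₁ <+: a₂ :=
    List.prefix_of_prefix_length_le (List.prefix_append a₁ _) (heq ▸ List.prefix_append a₂ _) hle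
  rw [List.append_assoc, List.append_cancel_left_eq] at heq
  rw [List.length_append] at hl
  have hc : c <+: wpow g₁ n₁ :=
    List.prefix_of_prefix_length_le (l₃ := wpow g₁ n₁ ++ b₁)
      (heq ▸ List.prefix_append _ _) (List.prefix_append _ _) (by rw [length_wpow]; omega)
  -- `x` is the period of the first run read from the start of the second. The remainder `r` of the
  -- first run begins with a word of length `|x| + |g₂|` having both periods.
  obtain ⟨x, hx, hxl⟩ := exists_append_eq_of_prefix hc
  obtain ⟨r, hr'⟩ := hc
  have hrl : c.length + r.length = n₁ * g₁.length := by
    rw [← List.length_append, hr', length_wpow]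
  have hrx : r <+: wpow x n₁ := by
    have := wpow_append_eq hx n₁
    rw [← hr', List.append_assoc, List.append_cancel_left_eq] at this
    exact this ▸ List.prefix_append r c
  rw [← hr', List.append_assoc, List.append_cancel_left_eq] at heq
  have hT : (r.take (x.length + g₂.length)).length = x.length + g₂.length := by
    rw [List.length_take]; omega
  have hcomm : x ++ g₂ = g₂ ++ x := by
    refine append_comm_of_prefix ((List.take_prefix _ r).trans hrx) (n := n₂) ?_ hT
    refine List.prefix_of_prefix_length_le
      ((List.take_prefix _ r).trans (heq ▸ List.prefix_append r b₁)) (List.prefix_append _ b₂) ?_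
    rw [hT, length_wpow]; omega
  obtain ⟨z, k, l, rfl, h2⟩ := exists_wpow_of_append_comm x g₂ hcomm
  obtain ⟨w, hw, hp⟩ := exists_wpow_of_append_eq c hx
  exact ⟨w, z, k, l, hw, h2, hp⟩

/-- Both periods are powers of words with the same letters, so each letter has the same density in
them. -/
theorem Overlap.countP_mul {a₁ g₁ b₁ a₂ g₂ b₂ : List α} {n₁ n₂ : ℕ}
    (h : Overlap a₁ g₁ b₁ a₂ g₂ b₂ n₁ n₂) (q : α → Bool) :
    g₁.countP q * g₂.length = g₂.countP q * g₁.length := by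
  obtain ⟨w₁, w₂, k, l, rfl, rfl, hp⟩ := h.exists_wpow
  simp only [countP_wpow, length_wpow, hp.countP_eq, hp.length_eq]
  ring

/-- The roots have equal length, so for nonempty roots `hl` becomes `k * t = l * s`, and coprimality
makes `s` divide the exponent `k`. -/
theorem Overlap.exists_root {a₁ g₁ b₁ a₂ g₂ b₂ : List α} {n₁ n₂ s t : ℕ}
    (h : Overlap a₁ g₁ b₁ a₂ g₂ b₂ n₁ n₂) (hst : s.Coprime t)
    (hl : g₁.length * t = g₂.length * s) : ∃ w, g₁ = wpow w s := by
  obtain ⟨w₁, w₂, k, l, rfl, rfl, hp⟩ := h.exists_wpow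
  rcases Nat.eq_zero_or_pos w₁.length with h0 | h0
  · rw [List.length_eq_zero_iff] at h0
    subst h0
    exact ⟨[], by simp⟩
  · rw [length_wpow, length_wpow, ← hp.length_eq] at hl
    have hkl : k * t = l * s := by
      apply Nat.eq_of_mul_eq_mul_right h0
      linarith
    obtain ⟨m, rfl⟩ : s ∣ k := hst.dvd_of_dvd_mul_right ⟨l, by rw [hkl, mul_comm]⟩
    exact ⟨wpow w₁ m, by rw [← wpow_mul, mul_comm]⟩

/-- Overlapping runs of the same period can be lengthened simultaneously. -/
theorem Overlap.wpow_succ_eq {a₁ g₁ b₁ a₂ g₂ b₂ : List α} {n₁ n₂ : ℕ}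
    (h : Overlap a₁ g₁ b₁ a₂ g₂ b₂ n₁ n₂) (hn₁ : 1 ≤ n₁) (hn₂ : 1 ≤ n₂)
    (hg : g₁.length = g₂.length) :
    a₁ ++ wpow g₁ (n₁ + 1) ++ b₁ = a₂ ++ wpow g₂ (n₂ + 1) ++ b₂ := by
  wlog hle : a₁.length ≤ a₂.length generalizing a₁ g₁ b₁ a₂ g₂ b₂ n₁ n₂
  · exact (this h.symm hn₂ hn₁ hg.symm (by omega)).symm
  obtain ⟨heq, hl, -, -, -⟩ := h
  rw [List.append_assoc, List.append_assoc] at heq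
  obtain ⟨c, rfl⟩ : a₁ <+: a₂ :=
    List.prefix_of_prefix_length_le (List.prefix_append a₁ _) (heq ▸ List.prefix_append a₂ _) hle
  rw [List.append_assoc, List.append_cancel_left_eq] at heq
  rw [List.length_append] at hl
  have hcg : c ++ g₂ <+: wpow g₁ n₁ := by
    refine List.prefix_of_prefix_length_le (l₃ := wpow g₁ n₁ ++ b₁) ?_ (List.prefix_append _ _)
      (by rw [length_wpow, List.length_append]; omega)
    rw [heq, List.prefix_append_right_inj]
    obtain ⟨k, rfl⟩ := Nat.exists_eq_add_of_le' hn₂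
    rw [wpow_succ, List.append_assoc]
    exact List.prefix_append _ _
  -- Both sides are prefixes of one power of `g₁` and have the same length. An extra `g₁` carried
  -- across the offset `c` thus becomes an extra `g₂`.
  have key : g₁ ++ c = c ++ g₂ := by
    have h1 : c ++ g₂ <+: wpow g₁ (n₁ + 1) := hcg.trans (wpow_prefix_wpow g₁ (by omega))
    have h2 : g₁ ++ c <+: wpow g₁ (n₁ + 1) := by
      rw [wpow_succ, List.prefix_append_right_inj]
      exact (List.prefix_append c g₂).trans hcg
    exact (List.prefix_of_prefix_length_le h2 h1 (by simp; omega)).eq_of_length (by simp; omega)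
  calc a₁ ++ wpow g₁ (n₁ + 1) ++ b₁ = a₁ ++ (g₁ ++ (wpow g₁ n₁ ++ b₁)) := by
        simp [wpow_succ]
    _ = a₁ ++ ((g₁ ++ c) ++ (wpow g₂ n₂ ++ b₂)) := by rw [heq]; simp
    _ = a₁ ++ c ++ wpow g₂ (n₂ + 1) ++ b₂ := by rw [key]; simp [wpow_succ]

end RAAG
namespace RAAG

variable {V : Type*} {Γ : SimpleGraph V}

/-! ### Words and the group elements they represent -/

/-- The formal inverse of a letter. -/
def letterInv (x : V × Bool) : V × Bool := (x.1, !x.2)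

@[simp] theorem letterInv_fst (x : V × Bool) : (letterInv x).1 = x.1 := rfl

@[simp] theorem letterInv_letterInv (x : V × Bool) : letterInv (letterInv x) = x := by
  simp [letterInv]

theorem ofWord_nil : ofWord Γ [] = 1 := rfl

theorem ofWord_append (w w' : List (V × Bool)) :
    ofWord Γ (w ++ w') = ofWord Γ w * ofWord Γ w' := by
  simp only [ofWord, ← map_mul, FreeGroup.mul_mk]

theorem ofWord_cons (x : V × Bool) (w : List (V × Bool)) :
    ofWord Γ (x :: w) = ofWord Γ [x] * ofWord Γ w :=
  ofWord_append [x] w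

theorem ofWord_surjective (g : Grp Γ) : ∃ w, ofWord Γ w = g := by
  obtain ⟨f, rfl⟩ := PresentedGroup.mk_surjective _ g
  obtain ⟨w, rfl⟩ := Quot.exists_rep f
  exact ⟨w, rfl⟩

theorem ofWord_singleton_true (v : V) : ofWord Γ [(v, true)] = gen Γ v := rfl

theorem ofWord_singleton_false (v : V) : ofWord Γ [(v, false)] = (gen Γ v)⁻¹ := rfl

theorem ofWord_letterInv (x : V × Bool) :
    ofWord Γ [letterInv x] = (ofWord Γ [x])⁻¹ := by
  obtain ⟨v, _ | _⟩ := x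
  · simp [letterInv, ofWord_singleton_true, ofWord_singleton_false]
  · simp [letterInv, ofWord_singleton_true, ofWord_singleton_false]

theorem commute_gen {u v : V} (huv : ¬ Γ.Adj u v) : Commute (gen Γ u) (gen Γ v) := by
  have h : (PresentedGroup.mk _ (FreeGroup.of u * FreeGroup.of v * (FreeGroup.of u)⁻¹ *
      (FreeGroup.of v)⁻¹) : Grp Γ) = 1 :=
    PresentedGroup.one_of_mem ⟨u, v, huv, rfl⟩
  simp only [map_mul, map_inv] at h
  rw [mul_inv_eq_one, mul_inv_eq_iff_eq_mul] at h
  exact h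

theorem commute_ofWord_singleton {x y : V × Bool} (hxy : ¬ Γ.Adj x.1 y.1) :
    Commute (ofWord Γ [x]) (ofWord Γ [y]) := by
  have h := commute_gen hxy
  obtain ⟨u, _ | _⟩ := x <;> obtain ⟨v, _ | _⟩ := y <;>
    simpa [ofWord_singleton_true, ofWord_singleton_false] using h

theorem commute_ofWord {x : V × Bool} {w : List (V × Bool)} (h : ∀ y ∈ w, ¬ Γ.Adj x.1 y.1) :
    Commute (ofWord Γ [x]) (ofWord Γ w) := by
  induction w with
  | nil => exact Commute.one_right _
  | cons y w ih =>
    rw [ofWord_cons]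
    exact (commute_ofWord_singleton (h y (by simp))).mul_right
      (ih fun z hz => h z (by simp [hz]))

theorem ofWord_move {x : V × Bool} {p q : List (V × Bool)} (hp : ∀ y ∈ p, ¬ Γ.Adj x.1 y.1) :
    ofWord Γ (p ++ x :: q) = ofWord Γ [x] * ofWord Γ (p ++ q) := by
  rw [ofWord_append, ofWord_cons, ofWord_append, ← mul_assoc, ← mul_assoc,
    (commute_ofWord hp).eq]

/-! ### Reduced words -/

theorem exists_isReducedWord (g : Grp Γ) : ∃ w, IsReducedWord Γ w ∧ ofWord Γ w = g := by
  have hne : {n : ℕ | ∃ w, ofWord Γ w = g ∧ w.length = n}.Nonempty := by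
    obtain ⟨w, hw⟩ := ofWord_surjective g
    exact ⟨_, w, hw, rfl⟩
  obtain ⟨w, hw, hl⟩ := Nat.sInf_mem hne
  refine ⟨w, fun w' hw' => ?_, hw⟩
  rw [hl]
  exact Nat.sInf_le ⟨w', hw'.trans hw, rfl⟩

theorem wordLength_le (w : List (V × Bool)) : wordLength (ofWord Γ w) ≤ w.length :=
  Nat.sInf_le ⟨w, rfl, rfl⟩

theorem isReducedWord_iff {w : List (V × Bool)} :
    IsReducedWord Γ w ↔ w.length = wordLength (ofWord Γ w) := by
  constructor
  · intro h
    refine le_antisymm (le_csInf ⟨_, w, rfl, rfl⟩ ?_) (wordLength_le w)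
    rintro n ⟨w', hw', rfl⟩
    exact h w' hw'
  · intro h w' hw'
    rw [h, ← hw']
    exact wordLength_le w'

theorem IsReducedWord.of_append_right {w w' : List (V × Bool)}
    (h : IsReducedWord Γ (w ++ w')) : IsReducedWord Γ w' := by
  intro w'' hw''
  have := h (w ++ w'') (by rw [ofWord_append, ofWord_append, hw''])
  simpa using this

theorem ofWord_wpow (w : List (V × Bool)) (n : ℕ) : ofWord Γ (wpow w n) = ofWord Γ w ^ n := by
  induction n with
  | zero => simp [ofWord_nil]
  | succ n ih => rw [wpow_succ, ofWord_append, ih, pow_succ']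

/-! ### Geodesic decompositions -/

theorem IsGeodesicPowerDecomposition.eq {h a g b : Grp Γ} {n : ℕ}
    (hd : IsGeodesicPowerDecomposition h a g n b) : h = a * g ^ n * b := by
  simpa [mul_assoc] using hd.1

theorem IsGeodesicPowerDecomposition.wordLength_eq {h a g b : Grp Γ} {n : ℕ}
    (hd : IsGeodesicPowerDecomposition h a g n b) :
    wordLength h = wordLength a + n * wordLength g + wordLength b := by
  simpa [add_assoc] using hd.2

/-! ### Projections to dependent pairs of vertices -/

/-- The pairs of vertices that are equal or adjacent. -/
abbrev DepPair (Γ : SimpleGraph V) : Type _ := {e : V × V // e.1 = e.2 ∨ Γ.Adj e.1 e.2}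

/-- A vertex belongs to a dependent pair. -/
def DepPair.Has (e : DepPair Γ) (v : V) : Prop := v = e.1.1 ∨ v = e.1.2

instance [DecidableEq V] (e : DepPair Γ) : DecidablePred e.Has :=
  fun _ => inferInstanceAs (Decidable (_ ∨ _))

/-- The pair `(v, v)`. -/
def DepPair.diag (Γ : SimpleGraph V) (v : V) : DepPair Γ := ⟨(v, v), Or.inl rfl⟩

/-- The pair of endpoints of an edge. -/
def DepPair.edge {u v : V} (h : Γ.Adj u v) : DepPair Γ := ⟨(u, v), Or.inr h⟩

@[simp] theorem DepPair.diag_has {u v : V} : (DepPair.diag Γ v).Has u ↔ u = v := by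
  simp [DepPair.diag, DepPair.Has]

@[simp] theorem DepPair.edge_has {u v w : V} (h : Γ.Adj u v) :
    (DepPair.edge h).Has w ↔ w = u ∨ w = v := by
  simp [DepPair.edge, DepPair.Has]

theorem DepPair.eq_or_adj {e : DepPair Γ} {u v : V} (hu : e.Has u) (hv : e.Has v) :
    u = v ∨ Γ.Adj u v := by
  obtain ⟨⟨a, b⟩, h⟩ := e
  simp only [DepPair.Has] at *
  rcases hu with rfl | rfl <;> rcases hv with rfl | rfl <;>
    simp_all [SimpleGraph.adj_comm, eq_comm]

variable [DecidableEq V]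

/-- The subword of the letters over the vertices of a dependent pair. -/
def proj (w : List (V × Bool)) (e : DepPair Γ) : List (V × Bool) := w.filter fun x => e.Has x.1

theorem proj_append (w w' : List (V × Bool)) (e : DepPair Γ) :
    proj (w ++ w') e = proj w e ++ proj w' e := by
  simp [proj]

/-- Add a letter in front of all projections that see it. -/
def push (x : V × Bool) (s : DepPair Γ → List (V × Bool)) : DepPair Γ → List (V × Bool) :=
  fun e => if e.Has x.1 then x :: s e else s e

/-- Remove the first letter of all projections that see the vertex of `x`. -/
def pop (x : V × Bool) (s : DepPair Γ → List (V × Bool)) : DepPair Γ → List (V × Bool) :=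
  fun e => if e.Has x.1 then (s e).tail else s e

/-- All projections that see `x` start with `x`. -/
def Top (x : V × Bool) (s : DepPair Γ → List (V × Bool)) : Prop :=
  ∀ e : DepPair Γ, e.Has x.1 → (s e).head? = some x

theorem proj_nil : proj (Γ := Γ) ([] : List (V × Bool)) = fun _ => [] := rfl

theorem proj_cons (x : V × Bool) (w : List (V × Bool)) :
    proj (Γ := Γ) (x :: w) = push x (proj w) := by
  funext e
  by_cases h : e.Has x.1 <;> simp [proj, push, h]

theorem pop_push (x y : V × Bool) (h : x.1 = y.1) (s : DepPair Γ → List (V × Bool)) :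
    pop x (push y s) = s := by
  funext e
  by_cases he : e.Has y.1 <;> simp [push, pop, he, h]

theorem top_push (x : V × Bool) (s : DepPair Γ → List (V × Bool)) : Top x (push x s) := by
  intro e he
  simp [push, he]

theorem push_comm {x y : V × Bool} (hne : x.1 ≠ y.1) (hadj : ¬ Γ.Adj x.1 y.1)
    (s : DepPair Γ → List (V × Bool)) : push x (push y s) = push y (push x s) := by
  funext e
  by_cases hx : e.Has x.1 <;> by_cases hy : e.Has y.1 <;> simp [push, hx, hy]
  exact ((DepPair.eq_or_adj hx hy).elim hne hadj).elim

theorem top_push_iff {x y : V × Bool} (hne : x.1 ≠ y.1) (hadj : ¬ Γ.Adj x.1 y.1)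
    (s : DepPair Γ → List (V × Bool)) : Top x (push y s) ↔ Top x s := by
  refine forall₂_congr fun e hx => ?_
  have hy : ¬ e.Has y.1 := fun hy => (DepPair.eq_or_adj hx hy).elim hne hadj
  simp [push, hy]

/-- If the vertices coincide or are adjacent, some projection sees both letters, and its first
letter is `y`. -/
theorem eq_or_indep_of_top_push {x y : V × Bool} {s : DepPair Γ → List (V × Bool)}
    (h : Top x (push y s)) : x = y ∨ (x.1 ≠ y.1 ∧ ¬ Γ.Adj x.1 y.1) := by
  by_cases hxy : x.1 = y.1
  · left
    have := h (DepPair.diag Γ x.1) (by simp)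
    simpa [push, hxy, eq_comm] using this
  · refine Or.inr ⟨hxy, fun hadj => hxy ?_⟩
    have := h (DepPair.edge hadj) (by simp)
    simp only [push, DepPair.edge_has, or_true, if_true, List.head?_cons, Option.some.injEq] at this
    rw [this]

/-- A letter on top of the projections of a word can be moved to the front. -/
theorem exists_eq_append_of_top {x : V × Bool} {w : List (V × Bool)}
    (h : Top x (proj (Γ := Γ) w)) :
    ∃ p q, w = p ++ x :: q ∧ ∀ y ∈ p, x.1 ≠ y.1 ∧ ¬ Γ.Adj x.1 y.1 := by
  induction w with
  | nil =>
    have := h (DepPair.diag Γ x.1) (by simp)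
    simp [proj] at this
  | cons y w ih =>
    rw [proj_cons] at h
    rcases eq_or_indep_of_top_push h with rfl | hxy
    · exact ⟨[], w, rfl, by simp⟩
    · obtain ⟨p, q, rfl, hp⟩ := ih ((top_push_iff hxy.1 hxy.2 _).1 h)
      exact ⟨y :: p, q, rfl, List.forall_mem_cons.2 ⟨hxy, hp⟩⟩

theorem proj_move {x : V × Bool} {p q : List (V × Bool)}
    (hp : ∀ y ∈ p, x.1 ≠ y.1 ∧ ¬ Γ.Adj x.1 y.1) :
    proj (Γ := Γ) (p ++ x :: q) = proj (x :: (p ++ q)) := by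
  induction p with
  | nil => rfl
  | cons y p ih =>
    have hy := hp y (by simp)
    rw [List.cons_append, proj_cons, ih fun z hz => hp z (by simp [hz]), proj_cons,
      ← push_comm hy.1 hy.2, List.cons_append, proj_cons, proj_cons]

theorem push_injective (x : V × Bool) :
    Function.Injective (push (Γ := Γ) x) := fun s t h => by
  rw [← pop_push x x rfl s, h, pop_push x x rfl]

/-- A word is determined, as a group element, by its projections. -/
theorem ofWord_eq_of_proj_eq {w w' : List (V × Bool)} (h : proj (Γ := Γ) w = proj w') :
    ofWord Γ w = ofWord Γ w' := by
  induction w generalizing w' with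
  | nil =>
    cases w' with
    | nil => rfl
    | cons x w' =>
      have := congrFun h (DepPair.diag Γ x.1)
      simp [proj_cons, push, proj_nil] at this
  | cons x w ih =>
    have ht : Top x (proj (Γ := Γ) w') := by
      rw [← h, proj_cons]
      exact top_push x _
    obtain ⟨p, q, rfl, hp⟩ := exists_eq_append_of_top ht
    rw [proj_move hp, proj_cons, proj_cons] at h
    rw [ofWord_cons, ofWord_move fun y hy => (hp y hy).2, ih (push_injective x h)]

/-! ### The action on reduced families of projections -/

/-- The families of projections of words without cancellation. -/
inductive Good : (DepPair Γ → List (V × Bool)) → Prop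
  | nil : Good fun _ => []
  | push (x : V × Bool) (s : DepPair Γ → List (V × Bool)) (hs : Good s)
      (hx : ¬ Top (letterInv x) s) : Good (push x s)

/-- Every letter pushed after the topmost `x` is independent of it, so the pushes can be reordered
to make `x` the last one without creating a cancellation. -/
theorem Good.exists_eq_push {s : DepPair Γ → List (V × Bool)} (hs : Good s) {x : V × Bool}
    (hx : Top x s) : ∃ s', s = RAAG.push x s' ∧ Good s' ∧ ¬ Top (letterInv x) s' := by
  induction hs with
  | nil =>
    have := hx (DepPair.diag Γ x.1) (by simp)
    simp at this
  | push y s hs hy ih =>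
    rcases eq_or_indep_of_top_push hx with rfl | hxy
    · exact ⟨s, rfl, hs, hy⟩
    · obtain ⟨s', rfl, hs', hx'⟩ := ih ((top_push_iff hxy.1 hxy.2 _).1 hx)
      have hyx : y.1 ≠ x.1 ∧ ¬ Γ.Adj y.1 x.1 := ⟨hxy.1.symm, fun h => hxy.2 h.symm⟩
      refine ⟨RAAG.push y s', (push_comm hxy.1 hxy.2 s').symm, .push y s' hs' ?_, ?_⟩
      · rwa [top_push_iff (by simpa using hyx.1) (by simpa using hyx.2)] at hy
      · rwa [top_push_iff (by simpa using hxy.1) (by simpa using hxy.2)]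

open Classical in
/-- Left multiplication by a letter. -/
noncomputable def letterAct (x : V × Bool) (s : {s : DepPair Γ → List (V × Bool) // Good s}) :
    {s : DepPair Γ → List (V × Bool) // Good s} :=
  if h : Top (letterInv x) s.1 then ⟨pop x s.1, by
    obtain ⟨s', hs, hs', -⟩ := s.2.exists_eq_push h
    rw [hs, pop_push x (letterInv x) rfl]
    exact hs'⟩
  else ⟨push x s.1, .push x s.1 s.2 h⟩

theorem letterAct_of_not_top {x : V × Bool} {s : {s : DepPair Γ → List (V × Bool) // Good s}}
    (h : ¬ Top (letterInv x) s.1) : (letterAct x s).1 = push x s.1 := by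
  simp [letterAct, h]

theorem letterAct_of_eq_push {x : V × Bool} {s : {s : DepPair Γ → List (V × Bool) // Good s}}
    {s' : DepPair Γ → List (V × Bool)} (h : s.1 = push (letterInv x) s') :
    (letterAct x s).1 = s' := by
  have ht : Top (letterInv x) s.1 := by
    rw [h]
    exact top_push _ _
  simp only [letterAct, ht, dif_pos]
  rw [h, pop_push x (letterInv x) rfl]

theorem letterAct_letterInv (x : V × Bool) (s : {s : DepPair Γ → List (V × Bool) // Good s}) :
    letterAct x (letterAct (letterInv x) s) = s := by
  apply Subtype.ext
  by_cases h : Top x s.1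
  · obtain ⟨s', hs, hs', hx⟩ := s.2.exists_eq_push h
    have h1 : (letterAct (letterInv x) s).1 = s' := letterAct_of_eq_push (by simpa using hs)
    rw [letterAct_of_not_top (by rwa [h1]), h1, hs]
  · exact letterAct_of_eq_push (letterAct_of_not_top (by simpa using h))

/-- No projection sees two independent letters, so neither affects whether the other cancels. This
is what makes the defining relations hold for the action. -/
theorem letterAct_comm {x y : V × Bool} (hne : x.1 ≠ y.1) (hadj : ¬ Γ.Adj x.1 y.1)
    (s : {s : DepPair Γ → List (V × Bool) // Good s}) :
    letterAct x (letterAct y s) = letterAct y (letterAct x s) := by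
  have hne' := hne.symm
  have hadj' : ¬ Γ.Adj y.1 x.1 := fun h => hadj h.symm
  have hxy : ∀ s : DepPair Γ → List (V × Bool),
      Top (letterInv x) (push y s) ↔ Top (letterInv x) s := 
    fun s => top_push_iff (x := letterInv x) hne hadj s
  have hyx : ∀ s : DepPair Γ → List (V × Bool),
      Top (letterInv y) (push x s) ↔ Top (letterInv y) s := 
    fun s => top_push_iff (x := letterInv y) hne' hadj' s
  apply Subtype.ext
  by_cases hx : Top (letterInv x) s.1
  · obtain ⟨s', hs, hs', hx'⟩ := s.2.exists_eq_push hx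
    have h1 : (letterAct x s).1 = s' := letterAct_of_eq_push hs
    have hys : Top (letterInv y) s.1 ↔ Top (letterInv y) s' := by
      rw [hs]; exact top_push_iff (x := letterInv y) (y := letterInv x) hne' hadj' s'
    by_cases hy : Top (letterInv y) s.1
    · obtain ⟨s'', hs2, -, -⟩ := hs'.exists_eq_push (hys.1 hy)
      have h2 : (letterAct y s).1 = push (letterInv x) s'' := by
        apply letterAct_of_eq_push
        rw [hs, hs2]
        exact push_comm (x := letterInv x) (y := letterInv y) hne hadj _
      rw [letterAct_of_eq_push h2, letterAct_of_eq_push (h1.trans hs2)]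
    · have h2 : (letterAct y s).1 = push (letterInv x) (push y s') := by
        rw [letterAct_of_not_top hy, hs]
        exact push_comm (y := letterInv x) hne' hadj' _
      rw [letterAct_of_eq_push h2, letterAct_of_not_top (by rw [h1]; exact fun h => hy (hys.2 h)),
        h1]
  · by_cases hy : Top (letterInv y) s.1
    · obtain ⟨s', hs, hs', hx'⟩ := s.2.exists_eq_push hy
      have h1 : (letterAct y s).1 = s' := letterAct_of_eq_push hs
      have hxs : Top (letterInv x) s.1 ↔ Top (letterInv x) s' := by
        rw [hs]; exact top_push_iff (x := letterInv x) (y := letterInv y) hne hadj s'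
      have h2 : (letterAct x s).1 = push (letterInv y) (push x s') := by
        rw [letterAct_of_not_top hx, hs]
        exact push_comm (y := letterInv y) hne hadj _
      rw [letterAct_of_eq_push h2, letterAct_of_not_top (by rw [h1]; exact fun h => hx (hxs.2 h)),
        h1]
    · have h1 := letterAct_of_not_top hx
      have h2 := letterAct_of_not_top hy
      rw [letterAct_of_not_top (s := letterAct y s) (by rwa [h2, hxy]),
        letterAct_of_not_top (s := letterAct x s) (by rwa [h1, hyx]), h1, h2, push_comm hne hadj]

/-- Left multiplication by a vertex, as a permutation. -/
noncomputable def vertexPerm (Γ : SimpleGraph V) (v : V) :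
    Equiv.Perm {s : DepPair Γ → List (V × Bool) // Good s} where
  toFun := letterAct (v, true)
  invFun := letterAct (v, false)
  left_inv := letterAct_letterInv (v, false)
  right_inv := letterAct_letterInv (v, true)

/-- The action of the group on reduced families of projections. -/
noncomputable def actHom (Γ : SimpleGraph V) :
    Grp Γ →* Equiv.Perm {s : DepPair Γ → List (V × Bool) // Good s} :=
  PresentedGroup.toGroup (f := vertexPerm Γ) (by
    rintro r ⟨u, v, huv, rfl⟩
    simp only [map_mul, map_inv, FreeGroup.lift_apply_of]
    rw [mul_inv_eq_one, mul_inv_eq_iff_eq_mul]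
    -- A vertex is not adjacent to itself, so the relators include the trivial case `u = v`.
    rcases eq_or_ne u v with rfl | hne
    · rfl
    · ext1 s
      exact letterAct_comm (x := (u, true)) (y := (v, true)) hne huv s)

theorem actHom_singleton (x : V × Bool) (s : {s : DepPair Γ → List (V × Bool) // Good s}) :
    actHom Γ (ofWord Γ [x]) s = letterAct x s := by
  have h : ∀ v, actHom Γ (gen Γ v) = vertexPerm Γ v := fun v => PresentedGroup.toGroup.of _
  obtain ⟨v, _ | _⟩ := x
  · rw [ofWord_singleton_false, map_inv, h]
    rfl
  · rw [ofWord_singleton_true, h]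
    rfl

/-- Acting on the empty family writes the word down letter by letter. A cancellation would bring a
letter next to its inverse and produce a shorter word. -/
theorem IsReducedWord.actHom_eq {w : List (V × Bool)} (hw : IsReducedWord Γ w) :
    (actHom Γ (ofWord Γ w) ⟨_, .nil⟩).1 = proj w := by
  induction w with
  | nil => simp [ofWord_nil, proj_nil]
  | cons x w ih =>
    have ih := ih (hw.of_append_right (w := [x]))
    rw [ofWord_cons, map_mul, Equiv.Perm.mul_apply, actHom_singleton, letterAct_of_not_top, ih,
      proj_cons]
    rw [ih]
    intro ht
    obtain ⟨p, q, rfl, hp⟩ := exists_eq_append_of_top ht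
    have := hw (p ++ q) (by
      rw [ofWord_cons, ofWord_move fun y hy => (hp y hy).2, ofWord_letterInv, mul_inv_cancel_left])
    simp at this

/-- Two reduced words for the same element have the same projections. -/
theorem IsReducedWord.proj_eq {w w' : List (V × Bool)} (hw : IsReducedWord Γ w)
    (hw' : IsReducedWord Γ w') (h : ofWord Γ w = ofWord Γ w') :
    proj (Γ := Γ) w = proj w' := by
  rw [← hw.actHom_eq, h, hw'.actHom_eq]

end RAAG
namespace RAAG

variable {V : Type*} {Γ : SimpleGraph V} [DecidableEq V]

/-! ### Counting letters -/

/-- The number of letters of `w` over the vertex `v`. -/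
def cnt (v : V) (w : List (V × Bool)) : ℕ := w.countP fun x => x.1 = v

@[simp] theorem cnt_nil (v : V) : cnt v [] = 0 := rfl

theorem cnt_cons (v : V) (x : V × Bool) (w : List (V × Bool)) :
    cnt v (x :: w) = cnt v w + if x.1 = v then 1 else 0 := by
  simp [cnt, List.countP_cons]

@[simp] theorem cnt_append (v : V) (w w' : List (V × Bool)) :
    cnt v (w ++ w') = cnt v w + cnt v w' := by
  simp [cnt]

@[simp] theorem cnt_reverse (v : V) (w : List (V × Bool)) : cnt v w.reverse = cnt v w := by
  simp [cnt]

@[simp] theorem cnt_wpow (v : V) (w : List (V × Bool)) (n : ℕ) :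
    cnt v (wpow w n) = n * cnt v w := by
  simp [cnt]

theorem cnt_pos_iff {v : V} {w : List (V × Bool)} : 0 < cnt v w ↔ ∃ ε, (v, ε) ∈ w := by
  simp only [cnt, List.countP_pos_iff, decide_eq_true_eq]
  constructor
  · rintro ⟨⟨u, ε⟩, hx, rfl⟩
    exact ⟨ε, hx⟩
  · rintro ⟨ε, hx⟩
    exact ⟨_, hx, rfl⟩

theorem sum_cnt [Fintype V] (w : List (V × Bool)) : ∑ v, cnt v w = w.length := by
  induction w with
  | nil => simp
  | cons x w ih => simp [cnt_cons, Finset.sum_add_distrib, ih]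

theorem cnt_proj (v : V) (w : List (V × Bool)) (e : DepPair Γ) :
    cnt v (proj w e) = if e.Has v then cnt v w else 0 := by
  induction w with
  | nil => simp [proj]
  | cons x w ih =>
    rw [proj_cons, push, cnt_cons]
    by_cases hx : e.Has x.1 <;> by_cases hv : x.1 = v <;> by_cases hv' : e.Has v <;>
      simp_all [cnt_cons]

theorem cnt_proj_of_has {v : V} {e : DepPair Γ} (h : e.Has v) (w : List (V × Bool)) :
    cnt v (proj w e) = cnt v w := by
  rw [cnt_proj, if_pos h]

theorem length_proj [Fintype V] (w : List (V × Bool)) (e : DepPair Γ) :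
    (proj w e).length = ∑ v with e.Has v, cnt v w := by
  rw [← sum_cnt, Finset.sum_filter]
  simp only [cnt_proj]

theorem length_proj_diag (v : V) (w : List (V × Bool)) :
    (proj w (DepPair.diag Γ v)).length = cnt v w := by
  simp [proj, cnt, List.countP_eq_length_filter]

theorem proj_wpow (w : List (V × Bool)) (n : ℕ) (e : DepPair Γ) :
    proj (wpow w n) e = wpow (proj w e) n :=
  filter_wpow _ w n

theorem proj_reverse (w : List (V × Bool)) (e : DepPair Γ) :
    proj w.reverse e = (proj w e).reverse := by
  simp [proj]

/-! ### Roots of words -/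

/-- Keep, for each vertex `v`, the first `d v` letters over `v`. -/
def trunc : (V → ℕ) → List (V × Bool) → List (V × Bool)
  | _, [] => []
  | d, x :: w =>
    if 0 < d x.1 then x :: trunc (Function.update d x.1 (d x.1 - 1)) w else trunc d w

theorem trunc_congr {d d' : V → ℕ} {w : List (V × Bool)} (h : ∀ x ∈ w, d x.1 = d' x.1) :
    trunc d w = trunc d' w := by
  induction w generalizing d d' with
  | nil => rfl
  | cons x w ih =>
    have hx := h x (by simp)
    have hw : ∀ y ∈ w, d y.1 = d' y.1 := fun y hy => h y (by simp [hy])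
    rw [trunc, trunc, hx, ih hw]
    refine if_congr Iff.rfl (congrArg _ (ih fun y hy => ?_)) rfl
    by_cases hyx : y.1 = x.1 <;> simp [Function.update, hyx, hw y hy]

theorem trunc_zero {d : V → ℕ} {w : List (V × Bool)} (h : ∀ x ∈ w, d x.1 = 0) :
    trunc d w = [] := by
  induction w with
  | nil => rfl
  | cons x w ih =>
    rw [trunc, if_neg (by simp [h x (by simp)]), ih fun y hy => h y (by simp [hy])]

/-- Using up the quota of a vertex is invisible to the projections that do not see that vertex. -/
theorem proj_trunc (d : V → ℕ) (w : List (V × Bool)) (e : DepPair Γ) :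
    proj (trunc d w) e = trunc d (proj w e) := by
  induction w generalizing d with
  | nil => rfl
  | cons x w ih =>
    rw [trunc, proj_cons, push]
    by_cases hx : e.Has x.1
    · rw [if_pos hx, trunc]
      split_ifs with hd
      · rw [proj_cons, push, if_pos hx, ih]
      · exact ih d
    · rw [if_neg hx]
      split_ifs with hd
      · rw [proj_cons, push, if_neg hx, ih]
        refine trunc_congr fun y hy => ?_
        have hy' : e.Has y.1 := by simpa using (List.mem_filter.1 hy).2
        rw [Function.update_of_ne]
        rintro h
        exact hx (h ▸ hy')
      · exact ih d

theorem trunc_append {d : V → ℕ} {w r : List (V × Bool)}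
    (h : ∀ x ∈ w ++ r, cnt x.1 w = d x.1) : trunc d (w ++ r) = w := by
  induction w generalizing d with
  | nil => exact trunc_zero fun x hx => (h x hx).symm
  | cons x w ih =>
    have hx := h x (by simp)
    rw [cnt_cons, if_pos rfl] at hx
    rw [List.cons_append, trunc, if_pos (by omega), ih]
    intro y hy
    have hy' := h y (by simp only [List.cons_append, List.mem_cons, hy, or_true])
    rw [cnt_cons] at hy'
    by_cases hyx : y.1 = x.1
    · rw [hyx, Function.update_self]
      omega
    · rw [Function.update_of_ne hyx, ← hy', if_neg (Ne.symm hyx), add_zero]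

/-- A word all of whose projections are `s`-th powers represents an `s`-th power. -/
theorem exists_ofWord_eq_pow {g : List (V × Bool)} {s : ℕ} (hs : 1 ≤ s)
    (h : ∀ e : DepPair Γ, ∃ w, proj g e = wpow w s) : ∃ u : Grp Γ, ofWord Γ g = u ^ s := by
  -- The first `1/s` of the letters over each vertex project exactly to the root `w` in every
  -- projection, so the local roots glue.
  refine ⟨ofWord Γ (trunc (fun v => cnt v g / s) g), ?_⟩
  rw [← ofWord_wpow]
  apply ofWord_eq_of_proj_eq
  funext e
  obtain ⟨w, hw⟩ := h e
  rw [proj_wpow, proj_trunc, hw]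
  congr 1
  obtain ⟨k, rfl⟩ := Nat.exists_eq_add_of_le' hs
  have hmem : ∀ x ∈ w ++ wpow w k, e.Has x.1 := by
    rw [← wpow_succ, ← hw]
    intro x hx
    simpa using (List.mem_filter.1 hx).2
  rw [wpow_succ, trunc_append]
  intro x hx
  rw [← cnt_proj_of_has (hmem x hx) g, hw, cnt_wpow, Nat.mul_div_cancel_left _ (by omega)]

theorem IsPrimitive.eq_one_of_proj {g : List (V × Bool)} (hg : IsPrimitive (ofWord Γ g)) {s : ℕ}
    (hs : 1 ≤ s) (h : ∀ e : DepPair Γ, ∃ w, proj g e = wpow w s) : s = 1 := by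
  by_contra hne
  obtain ⟨u, hu⟩ := exists_ofWord_eq_pow hs h
  exact hg.2 ⟨u, s, by omega, hu⟩

/-! ### Supports -/

theorem IsReducedWord.cnt_eq {w w' : List (V × Bool)} (hw : IsReducedWord Γ w)
    (hw' : IsReducedWord Γ w') (h : ofWord Γ w = ofWord Γ w') (v : V) : cnt v w = cnt v w' := by
  rw [← length_proj_diag (Γ := Γ), hw.proj_eq hw' h, length_proj_diag]

theorem IsReducedWord.supp_eq {w : List (V × Bool)} (hw : IsReducedWord Γ w) :
    supp (ofWord Γ w) = {v | 0 < cnt v w} := by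
  ext v
  simp only [supp, Set.mem_ofPred_eq]
  constructor
  · rintro ⟨w', hw', h, hv⟩
    rw [hw.cnt_eq hw' h.symm]
    exact cnt_pos_iff.2 hv
  · intro hv
    exact ⟨w, hw, rfl, cnt_pos_iff.1 hv⟩

theorem supp_gen_subset (v : V) : supp (gen Γ v) ⊆ {v} := by
  rintro u ⟨w, hw, h, hu⟩
  have hl := hw [(v, true)] h.symm
  have hpos : 0 < cnt u w := cnt_pos_iff.2 hu
  -- The nonempty reduced word `w` already shows that the generator has length at least one; its
  -- nontriviality needs no separate proof.
  have hr : IsReducedWord Γ [(v, true)] := by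
    intro w' hw'
    have h1 : 0 < w.length := hpos.trans_le List.countP_le_length
    have h2 := hw w' (hw'.trans h.symm)
    simp only [List.length_singleton]
    omega
  rw [hw.cnt_eq hr h, cnt_pos_iff] at hpos
  simpa using hpos

/-- The support of a strongly non-split element is dominating. -/
theorem StronglyNonSplit.exists_adj {w : List (V × Bool)} (hw : IsReducedWord Γ w)
    (h : StronglyNonSplit (ofWord Γ w)) {v : V} (hv : cnt v w = 0) :
    ∃ u, 0 < cnt u w ∧ Γ.Adj u v := by
  by_contra! hcon
  refine h.2 ⟨v, Set.disjoint_left.2 fun u hu hu' => ?_, fun u hu u' hu' hadj => ?_⟩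
  · rw [hw.supp_eq] at hu'
    obtain rfl := supp_gen_subset v hu
    exact absurd hv (ne_of_gt hu')
  · rw [hw.supp_eq] at hu'
    obtain rfl := supp_gen_subset v hu
    exact hcon u' hu' hadj.symm

/-! ### Prefixes of words containing a power -/

section Prefix

variable {a g b c r : List (V × Bool)} {n : ℕ}

/-- In the projection to `e`, `a ++ wpow g j` and `c` are prefixes of one word, so one is a prefix
of the other; the strict excess at `v` decides which. -/
theorem cnt_le_of_lt_of_has (h : ∀ e : DepPair Γ, proj (a ++ wpow g n ++ b) e = proj (c ++ r) e)
    {j : ℕ} (hj : j ≤ n) {e : DepPair Γ} {u v : V} (hu : e.Has u) (hv : e.Has v)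
    (hlt : cnt v a + j * cnt v g < cnt v c) : cnt u a + j * cnt u g ≤ cnt u c := by
  have h1 : proj (a ++ wpow g j) e <+: proj (c ++ r) e := by
    obtain ⟨k, rfl⟩ := Nat.exists_eq_add_of_le hj
    rw [← h, wpow_add, ← List.append_assoc, List.append_assoc, proj_append (a ++ wpow g j)]
    exact List.prefix_append _ _
  have h2 : proj c e <+: proj (c ++ r) e := by
    rw [proj_append]
    exact List.prefix_append _ _
  rcases List.prefix_or_prefix_of_prefix h1 h2 with h3 | h3
  · have := h3.sublist.countP_le (p := fun x => x.1 = u)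
    change cnt u _ ≤ cnt u _ at this
    simpa [cnt_proj_of_has hu] using this
  · have := h3.sublist.countP_le (p := fun x => x.1 = v)
    change cnt v _ ≤ cnt v _ at this
    simp [cnt_proj_of_has hv] at this
    omega

/-- Each edge costs one block: giving up a block makes the inequality strict at a support vertex,
which is what passes it on to the neighbour. -/
theorem cnt_le_of_walk (h : ∀ e : DepPair Γ, proj (a ++ wpow g n ++ b) e = proj (c ++ r) e)
    {v u : {v | 0 < cnt v g}} (p : (Γ.induce {v | 0 < cnt v g}).Walk v u) {j : ℕ}
    (hj : j + p.length ≤ n + 1) (hv : cnt v.1 a + (j + p.length) * cnt v.1 g ≤ cnt v.1 c) :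
    cnt u.1 a + j * cnt u.1 g ≤ cnt u.1 c := by
  induction p with
  | nil => simpa using hv
  | @cons v w u hadj p ih =>
    rw [SimpleGraph.Walk.length_cons] at hj hv
    have hadj' : Γ.Adj v.1 w.1 := hadj
    have hpos : 0 < cnt v.1 g := v.2
    refine ih (by omega) (cnt_le_of_lt_of_has h (by omega) (e := DepPair.edge hadj') (v := v.1)
      (by simp) (by simp) ?_)
    rw [← add_assoc, add_mul, one_mul] at hv
    omega

/-- A prefix of a word containing a power of a strongly non-split element reaches a given block of
the power only if it contains all blocks that are far to the left. -/
theorem cnt_le_of_length_lt [Fintype V] (hV : 2 ≤ Fintype.card V)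
    (h : ∀ e : DepPair Γ, proj (a ++ wpow g n ++ b) e = proj (c ++ r) e)
    (hconn : (Γ.induce {v | 0 < cnt v g}).Connected)
    (hdom : ∀ v, cnt v g = 0 → ∃ u, 0 < cnt u g ∧ Γ.Adj u v) {m : ℕ}
    (hm : m + (Fintype.card V - 1) ≤ n) (hlen : c.length < a.length + (m + 1) * g.length) (v : V) :
    cnt v c ≤ cnt v a + (m + (Fintype.card V - 1)) * cnt v g := by
  by_contra! hv
  -- With `m + 1` blocks at every support vertex, domination also forces `c` to contain the letters
  -- of `a` off the support, and `c` becomes too long.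
  suffices hS : ∀ u, 0 < cnt u g → cnt u a + (m + 1) * cnt u g ≤ cnt u c by
    refine absurd hlen (not_lt.2 ?_)
    rw [← sum_cnt, ← sum_cnt, ← sum_cnt, Finset.mul_sum, ← Finset.sum_add_distrib]
    refine Finset.sum_le_sum fun u _ => ?_
    rcases Nat.eq_zero_or_pos (cnt u g) with hu | hu
    · obtain ⟨w, hw, hadj⟩ := hdom u hu
      have := cnt_le_of_lt_of_has h (Nat.zero_le n) (e := DepPair.edge hadj) (u := u) (v := w)
        (by simp) (by simp) (by have := hS w hw; nlinarith)
      rw [hu]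
      omega
    · exact hS u hu
  have hmono : ∀ {u j}, m + 1 ≤ j → cnt u a + j * cnt u g ≤ cnt u c →
      cnt u a + (m + 1) * cnt u g ≤ cnt u c := fun hj hu =>
    (Nat.add_le_add_left (Nat.mul_le_mul_right _ hj) _).trans hu
  have hpath : ∀ v u : {v | 0 < cnt v g}, ∃ p : (Γ.induce {v | 0 < cnt v g}).Walk v u,
      p.length < Fintype.card {v | 0 < cnt v g} := fun v u => by
    obtain ⟨p⟩ := hconn.preconnected v u
    exact ⟨p.bypass, p.bypass_isPath.length_lt⟩
  intro u hu
  rcases Nat.eq_zero_or_pos (cnt v g) with hv0 | hv0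
  -- Off the support, the excess at `v` forces all `n` blocks at a neighbour. The support is then
  -- proper, so the walk costs at most `|V| - 2` blocks.
  · obtain ⟨w, hw, hadj⟩ := hdom v hv0
    have hwn : cnt w a + n * cnt w g ≤ cnt w c :=
      cnt_le_of_lt_of_has h le_rfl (e := DepPair.edge hadj) (v := v) (by simp) (by simp)
        (by simpa [hv0] using hv)
    obtain ⟨p, hp⟩ := hpath ⟨w, hw⟩ ⟨u, hu⟩
    have hcard : Fintype.card {v | 0 < cnt v g} < Fintype.card V :=
      Fintype.card_subtype_lt (x := v) (by simp [hv0])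
    refine hmono (j := n - p.length) (by omega) (cnt_le_of_walk h p (by omega) ?_)
    rwa [Nat.sub_add_cancel (by omega)]
  · obtain ⟨p, hp⟩ := hpath ⟨v, hv0⟩ ⟨u, hu⟩
    have hcard : Fintype.card {v | 0 < cnt v g} ≤ Fintype.card V := Fintype.card_subtype_le _
    cases p with
    | nil => exact hmono (by omega) hv.le
    -- The excess at `v` is already strict, so the first edge is free and again at most `|V| - 2`
    -- blocks are lost.
    | @cons _ w _ hadj p =>
      have hadj' : Γ.Adj v w.1 := hadj
      rw [SimpleGraph.Walk.length_cons] at hp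
      refine hmono (j := m + (Fintype.card V - 1) - p.length) (by omega)
        (cnt_le_of_walk h p (by omega) ?_)
      rw [Nat.sub_add_cancel (by omega)]
      exact cnt_le_of_lt_of_has h hm (e := DepPair.edge hadj') (v := v) (by simp) (by simp) hv

end Prefix

/-! ### Two powers in the same word -/

section Powers

variable [Fintype V] {a₁ g₁ b₁ a₂ g₂ b₂ : List (V × Bool)} {n₁ n₂ : ℕ}

theorem length_proj_le {x y z : List (V × Bool)} {i : ℕ}
    (h : ∀ v, cnt v x ≤ cnt v y + i * cnt v z) (e : DepPair Γ) :
    (proj x e).length ≤ (proj y e).length + i * (proj z e).length := by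
  simp only [length_proj, Finset.mul_sum, ← Finset.sum_add_distrib]
  exact Finset.sum_le_sum fun v _ => h v

theorem length_proj_of_card_eq_one (hV : Fintype.card V = 1) (w : List (V × Bool))
    (e : DepPair Γ) : (proj w e).length = w.length := by
  have := Fintype.card_le_one_iff_subsingleton.1 hV.le
  rw [proj, List.filter_eq_self.2]
  intro x _
  simp [DepPair.Has, Subsingleton.elim x.1 e.1.1]

/-- Let `m` and `m'` be the numbers of whole copies of `g₁` by which the maximal end lengths exceed
`|a₁|` and `|b₁|`. In projections, `a₂` reaches at most `m + |V| - 1` blocks into the run and `b₂`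
at most `m' + |V| - 1`. Of at least `m + m' + 2|V| + 1` blocks, three survive. -/
theorem max_add_max_add_le
    (h : ∀ e : DepPair Γ, proj (a₁ ++ wpow g₁ n₁ ++ b₁) e = proj (a₂ ++ wpow g₂ n₂ ++ b₂) e)
    (hconn : (Γ.induce {v | 0 < cnt v g₁}).Connected)
    (hdom : ∀ v, cnt v g₁ = 0 → ∃ u, 0 < cnt u g₁ ∧ Γ.Adj u v)
    (hlen : (2 * Fintype.card V + 1) * g₁.length + max a₁.length a₂.length +
      max b₁.length b₂.length ≤ a₁.length + n₁ * g₁.length + b₁.length) (e : DepPair Γ) :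
    max (proj a₁ e).length (proj a₂ e).length + max (proj b₁ e).length (proj b₂ e).length +
      3 * (proj g₁ e).length ≤
      (proj a₁ e).length + n₁ * (proj g₁ e).length + (proj b₁ e).length := by
  have hpos : 0 < Fintype.card V := Fintype.card_pos_iff.2 ⟨e.1.1⟩
  have hg : 0 < g₁.length := by
    obtain ⟨⟨v, hv⟩⟩ := hconn.nonempty
    exact lt_of_lt_of_le hv List.countP_le_length
  rcases Nat.lt_or_ge 1 (Fintype.card V) with hV | hV
  · set A := max a₁.length a₂.length with hA
    set B := max b₁.length b₂.length with hB
    have hA₁ : a₁.length ≤ A := le_max_left _ _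
    have hA₂ : a₂.length ≤ A := le_max_right _ _
    have hB₁ : b₁.length ≤ B := le_max_left _ _
    have hB₂ : b₂.length ≤ B := le_max_right _ _
    obtain ⟨m, hm⟩ : ∃ m, m = (A - a₁.length) / g₁.length := ⟨_, rfl⟩
    obtain ⟨m', hm'⟩ : ∃ m', m' = (B - b₁.length) / g₁.length := ⟨_, rfl⟩
    have h1 : m * g₁.length ≤ A - a₁.length := hm ▸ Nat.div_mul_le_self _ _
    have h1' : m' * g₁.length ≤ B - b₁.length := hm' ▸ Nat.div_mul_le_self _ _
    have h2 : A - a₁.length < (m + 1) * g₁.length := by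
      rw [hm, mul_comm]
      exact Nat.lt_mul_div_succ _ hg
    have h2' : B - b₁.length < (m' + 1) * g₁.length := by
      rw [hm', mul_comm]
      exact Nat.lt_mul_div_succ _ hg
    have hn : m + m' + 2 * Fintype.card V + 1 ≤ n₁ := by
      refine Nat.le_of_mul_le_mul_right ?_ hg
      have : (m + m' + 2 * Fintype.card V + 1) * g₁.length =
        m * g₁.length + m' * g₁.length + (2 * Fintype.card V + 1) * g₁.length := by ring
      omega
    have ha := length_proj_le (cnt_le_of_length_lt hV (r := wpow g₂ n₂ ++ b₂)
      (by simpa only [List.append_assoc] using h) hconn hdom (m := m) (by omega) (by omega)) e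
    have hset : {v | 0 < cnt v g₁.reverse} = {v | 0 < cnt v g₁} := by
      ext v
      simp
    -- The bound for suffixes is the bound for prefixes of the reversed word.
    have hb := length_proj_le (cnt_le_of_length_lt hV (Γ := Γ) (n := n₁) (a := b₁.reverse)
      (g := g₁.reverse) (b := a₁.reverse) (c := b₂.reverse) (r := (a₂ ++ wpow g₂ n₂).reverse)
      (fun e => by
        rw [← List.reverse_append, proj_reverse, ← h e, ← proj_reverse, List.reverse_append,
          List.reverse_append, reverse_wpow, List.append_assoc])
      (by rw [hset]; exact hconn) (by simpa using hdom) (m := m') (by omega)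
      (by simp only [List.length_reverse]; omega)) e
    simp only [proj_reverse, List.length_reverse] at hb
    set i := m + (Fintype.card V - 1)
    set i' := m' + (Fintype.card V - 1)
    have hi : i + i' + 3 ≤ n₁ := by omega
    have h3 := Nat.mul_le_mul_right (proj g₁ e).length hi
    rw [add_mul, add_mul] at h3
    omega
  -- With one vertex each projection is the whole word, and `2|V| + 1` is already the required `3`.
  · have hV1 : Fintype.card V = 1 := by omega
    simp only [length_proj_of_card_eq_one hV1]
    rw [hV1] at hlen
    omega

/-- The common core is at least three periods long for either period, hence at least as long as
their sum. -/
theorem overlap_of_length_le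
    (h : ∀ e : DepPair Γ, proj (a₁ ++ wpow g₁ n₁ ++ b₁) e = proj (a₂ ++ wpow g₂ n₂ ++ b₂) e)
    (hconn₁ : (Γ.induce {v | 0 < cnt v g₁}).Connected)
    (hconn₂ : (Γ.induce {v | 0 < cnt v g₂}).Connected)
    (hdom₁ : ∀ v, cnt v g₁ = 0 → ∃ u, 0 < cnt u g₁ ∧ Γ.Adj u v)
    (hdom₂ : ∀ v, cnt v g₂ = 0 → ∃ u, 0 < cnt u g₂ ∧ Γ.Adj u v)
    (hlen₁ : (2 * Fintype.card V + 1) * g₁.length + max a₁.length a₂.length +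
      max b₁.length b₂.length ≤ a₁.length + n₁ * g₁.length + b₁.length)
    (hlen₂ : (2 * Fintype.card V + 1) * g₂.length + max a₁.length a₂.length +
      max b₁.length b₂.length ≤ a₂.length + n₂ * g₂.length + b₂.length) (e : DepPair Γ) :
    Overlap (proj a₁ e) (proj g₁ e) (proj b₁ e) (proj a₂ e) (proj g₂ e) (proj b₂ e) n₁ n₂ := by
  have h1 := max_add_max_add_le h hconn₁ hdom₁ hlen₁ e
  have h2 := max_add_max_add_le (fun e => (h e).symm) hconn₂ hdom₂
    (by rwa [max_comm a₂.length, max_comm b₂.length]) e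
  have heq : proj a₁ e ++ wpow (proj g₁ e) n₁ ++ proj b₁ e =
      proj a₂ e ++ wpow (proj g₂ e) n₂ ++ proj b₂ e := by
    simpa only [proj_append, proj_wpow] using h e
  have hl := congrArg List.length heq
  simp only [List.length_append, length_wpow] at hl
  constructor
  · exact heq
  all_goals omega

theorem cnt_eq_of_overlap
    (h : ∀ e : DepPair Γ,
      Overlap (proj a₁ e) (proj g₁ e) (proj b₁ e) (proj a₂ e) (proj g₂ e) (proj b₂ e) n₁ n₂)
    (hconn : (Γ.induce {v | 0 < cnt v g₁}).Connected) (hp₁ : IsPrimitive (ofWord Γ g₁))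
    (hp₂ : IsPrimitive (ofWord Γ g₂)) (v : V) : cnt v g₁ = cnt v g₂ := by
  have hzero : ∀ v, cnt v g₁ = 0 ↔ cnt v g₂ = 0 := fun v => by
    have h1 := (h (DepPair.diag Γ v)).run_left
    have h2 := (h (DepPair.diag Γ v)).run_right
    simp only [length_proj_diag] at h1 h2
    constructor <;> intro h0 <;> simp only [h0, mul_zero] at h1 h2 <;> omega
  -- Equal density of the letters over `u` in the projection to the edge is, after cancelling the
  -- common product, equality of the ratios at `u` and `v`.
  have hedge : ∀ {u v}, Γ.Adj u v → cnt u g₁ * cnt v g₂ = cnt u g₂ * cnt v g₁ := by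
    intro u v huv
    have hl : ∀ w : List (V × Bool), (proj w (DepPair.edge huv)).length = cnt u w + cnt v w := by
      intro w
      have hf : (Finset.univ.filter fun x => (DepPair.edge huv).Has x) = {u, v} := by
        ext x
        simp
      rw [length_proj, hf, Finset.sum_pair huv.ne]
    have := (h (DepPair.edge huv)).countP_mul fun x => x.1 = u
    change cnt u _ * _ = cnt u _ * _ at this
    rw [hl, hl, cnt_proj_of_has (by simp), cnt_proj_of_has (by simp)] at this
    linarith
  obtain ⟨⟨v₀, hv₀⟩⟩ := hconn.nonempty
  have hv₀ : 0 < cnt v₀ g₁ := hv₀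
  have hratio : ∀ v, cnt v g₁ * cnt v₀ g₂ = cnt v g₂ * cnt v₀ g₁ := by
    intro v
    rcases Nat.eq_zero_or_pos (cnt v g₁) with hv | hv
    · rw [hv, (hzero v).1 hv]
      simp
    · obtain ⟨p⟩ := hconn.preconnected ⟨v, hv⟩ ⟨v₀, hv₀⟩
      have key : ∀ {v u : {v | 0 < cnt v g₁}}, (Γ.induce {v | 0 < cnt v g₁}).Walk v u →
          cnt v.1 g₁ * cnt u.1 g₂ = cnt v.1 g₂ * cnt u.1 g₁ := by
        intro v u p
        induction p with
        | nil => exact mul_comm _ _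
        | @cons v w u hadj p ih =>
          have h1 := hedge (show Γ.Adj v.1 w.1 from hadj)
          have hw : 0 < cnt w.1 g₁ := w.2
          apply Nat.eq_of_mul_eq_mul_right hw
          calc cnt v.1 g₁ * cnt u.1 g₂ * cnt w.1 g₁
              = cnt v.1 g₁ * (cnt w.1 g₁ * cnt u.1 g₂) := by ring
            _ = (cnt v.1 g₁ * cnt w.1 g₂) * cnt u.1 g₁ := by rw [ih]; ring
            _ = _ := by rw [h1]; ring
      exact key p
  -- `s : t` is the common ratio of letter counts in lowest terms, read off at `v₀`.
  obtain ⟨d, s, t, hd, hst, hs, ht⟩ :=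
    Nat.exists_coprime' (Nat.gcd_pos_of_pos_left (cnt v₀ g₂) hv₀)
  have hst' : ∀ v, cnt v g₁ * t = cnt v g₂ * s := fun v => by
    have := hratio v
    rw [hs, ht] at this
    apply Nat.eq_of_mul_eq_mul_right hd
    linarith
  have hs1 : 1 ≤ s := by
    rcases Nat.eq_zero_or_pos s with rfl | h
    · omega
    · exact h
  have ht1 : 1 ≤ t := by
    rcases Nat.eq_zero_or_pos t with rfl | h
    · have := (hzero v₀).2 (by omega)
      omega
    · exact h
  have hl : ∀ e : DepPair Γ, (proj g₁ e).length * t = (proj g₂ e).length * s := fun e => by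
    rw [length_proj, length_proj, Finset.sum_mul, Finset.sum_mul]
    exact Finset.sum_congr rfl fun v _ => hst' v
  have e1 := hp₁.eq_one_of_proj hs1 fun e => (h e).exists_root hst (hl e)
  have e2 := hp₂.eq_one_of_proj ht1 fun e => (h e).symm.exists_root hst.symm (hl e).symm
  simpa [e1, e2] using hst' v

end Powers

end RAAG

/-! ### Proof of the proposition -/

theorem mainTheorem3 {V : Type*} [Fintype V] (Γ : SimpleGraph V) (hΓ : Γ.Connected)
    (h a₁ a₂ b₁ b₂ g₁ g₂ : RAAG.Grp Γ) (n₁ n₂ : ℕ) (hn₁ : 1 ≤ n₁) (hn₂ : 1 ≤ n₂)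
    (hdec₁ : RAAG.IsGeodesicPowerDecomposition h a₁ g₁ n₁ b₁)
    (hdec₂ : RAAG.IsGeodesicPowerDecomposition h a₂ g₂ n₂ b₂)
    (hs₁ : RAAG.StronglyNonSplit g₁) (hs₂ : RAAG.StronglyNonSplit g₂)
    (hp₁ : RAAG.IsPrimitive g₁) (hp₂ : RAAG.IsPrimitive g₂)
    (A B : ℝ) (hA : 0 ≤ A) (hB : 0 ≤ B)
    (ha₁ : (RAAG.wordLength a₁ : ℝ) ≤ A) (ha₂ : (RAAG.wordLength a₂ : ℝ) ≤ A)
    (hb₁ : (RAAG.wordLength b₁ : ℝ) ≤ B) (hb₂ : (RAAG.wordLength b₂ : ℝ) ≤ B)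
    (hh₁ : (2 * (Fintype.card V : ℝ) + 1) * (RAAG.wordLength g₁ : ℝ) ≤
      (RAAG.wordLength h : ℝ) - (A + B))
    (hh₂ : (2 * (Fintype.card V : ℝ) + 1) * (RAAG.wordLength g₂ : ℝ) ≤
      (RAAG.wordLength h : ℝ) - (A + B)) :
    IsConj g₁ g₂ ∧
      a₁ * g₁ * a₁⁻¹ = a₂ * g₂ * a₂⁻¹ ∧
      b₁⁻¹ * g₁ * b₁ = b₂⁻¹ * g₂ * b₂ := by
  classical
  -- The real constants matter only through the maxima of the lengths that they bound.
  open RAAG in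
  have bound : ∀ g : Grp Γ, (2 * (Fintype.card V : ℝ) + 1) * (wordLength g : ℝ) ≤
      (wordLength h : ℝ) - (A + B) → (2 * Fintype.card V + 1) * wordLength g +
        max (wordLength a₁) (wordLength a₂) + max (wordLength b₁) (wordLength b₂) ≤
        wordLength h := by
    intro g hg
    have h1 := max_le ha₁ ha₂
    have h2 := max_le hb₁ hb₂
    rw [← Nat.cast_max] at h1 h2
    have : (((2 * Fintype.card V + 1) * wordLength g + max (wordLength a₁) (wordLength a₂) +
        max (wordLength b₁) (wordLength b₂) : ℕ) : ℝ) ≤ (wordLength h : ℝ) := by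
      push_cast at *
      linarith
    exact_mod_cast this
  have hl₁ := bound g₁ hh₁
  have hl₂ := bound g₂ hh₂
  have heq₁ := hdec₁.eq
  have heq₂ := hdec₂.eq
  have hlen₁ := hdec₁.wordLength_eq
  have hlen₂ := hdec₂.wordLength_eq
  rw [hlen₁] at hl₁
  rw [hlen₂] at hl₂
  obtain ⟨wa₁, hwa₁, rfl⟩ := RAAG.exists_isReducedWord a₁
  obtain ⟨wa₂, hwa₂, rfl⟩ := RAAG.exists_isReducedWord a₂
  obtain ⟨wb₁, hwb₁, rfl⟩ := RAAG.exists_isReducedWord b₁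
  obtain ⟨wb₂, hwb₂, rfl⟩ := RAAG.exists_isReducedWord b₂
  obtain ⟨wg₁, hwg₁, rfl⟩ := RAAG.exists_isReducedWord g₁
  obtain ⟨wg₂, hwg₂, rfl⟩ := RAAG.exists_isReducedWord g₂
  rw [← RAAG.ofWord_wpow, ← RAAG.ofWord_append, ← RAAG.ofWord_append] at heq₁ heq₂
  simp only [← RAAG.isReducedWord_iff.1 hwa₁, ← RAAG.isReducedWord_iff.1 hwa₂,
    ← RAAG.isReducedWord_iff.1 hwb₁, ← RAAG.isReducedWord_iff.1 hwb₂,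
    ← RAAG.isReducedWord_iff.1 hwg₁, ← RAAG.isReducedWord_iff.1 hwg₂] at hl₁ hl₂ hlen₁ hlen₂
  -- Geodesicity says precisely that concatenating reduced words for the factors gives a reduced
  -- word.
  have hr₁ : RAAG.IsReducedWord Γ (wa₁ ++ RAAG.wpow wg₁ n₁ ++ wb₁) := by
    rw [RAAG.isReducedWord_iff, ← heq₁, hlen₁]
    simp [add_assoc]
  have hr₂ : RAAG.IsReducedWord Γ (wa₂ ++ RAAG.wpow wg₂ n₂ ++ wb₂) := by
    rw [RAAG.isReducedWord_iff, ← heq₂, hlen₂]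
    simp [add_assoc]
  have hproj := congrFun (hr₁.proj_eq hr₂ (heq₁.symm.trans heq₂))
  have hc₁ := hs₁.1
  have hc₂ := hs₂.1
  rw [RAAG.NonSplit, RAAG.IsReducedWord.supp_eq ‹_›] at hc₁ hc₂
  have hov := RAAG.overlap_of_length_le hproj hc₁ hc₂ (fun v => hs₁.exists_adj hwg₁)
    (fun v => hs₂.exists_adj hwg₂) hl₁ hl₂
  have hcnt := RAAG.cnt_eq_of_overlap hov hc₁ hp₁ hp₂
  have hlong : RAAG.ofWord Γ (wa₁ ++ RAAG.wpow wg₁ (n₁ + 1) ++ wb₁) =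
      RAAG.ofWord Γ (wa₂ ++ RAAG.wpow wg₂ (n₂ + 1) ++ wb₂) := by
    apply RAAG.ofWord_eq_of_proj_eq
    funext e
    simp only [RAAG.proj_append, RAAG.proj_wpow]
    refine (hov e).wpow_succ_eq hn₁ hn₂ ?_
    rw [RAAG.length_proj, RAAG.length_proj]
    exact Finset.sum_congr rfl fun v _ => hcnt v
  simp only [RAAG.ofWord_append, RAAG.ofWord_wpow] at hlong heq₁ heq₂
  generalize RAAG.ofWord Γ wa₁ = a₁ at *
  generalize RAAG.ofWord Γ wa₂ = a₂ at *
  generalize RAAG.ofWord Γ wb₁ = b₁ at *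
  generalize RAAG.ofWord Γ wb₂ = b₂ at *
  generalize RAAG.ofWord Γ wg₁ = g₁ at *
  generalize RAAG.ofWord Γ wg₂ = g₂ at *
  have hconj : a₁ * g₁ * a₁⁻¹ = a₂ * g₂ * a₂⁻¹ := by
    -- The extra block leaves on the left of `h` as a conjugate by `a₁`; below, it leaves on the
    -- right as a conjugate by `b₁⁻¹`.
    have e₁ : a₁ * g₁ ^ (n₁ + 1) * b₁ = a₁ * g₁ * a₁⁻¹ * h := by rw [heq₁, pow_succ']; group
    have e₂ : a₂ * g₂ ^ (n₂ + 1) * b₂ = a₂ * g₂ * a₂⁻¹ * h := by rw [heq₂, pow_succ']; group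
    rw [e₁, e₂] at hlong
    exact mul_right_cancel hlong
  refine ⟨?_, hconj, ?_⟩
  · rw [isConj_iff]
    refine ⟨a₂⁻¹ * a₁, ?_⟩
    calc a₂⁻¹ * a₁ * g₁ * (a₂⁻¹ * a₁)⁻¹ = a₂⁻¹ * (a₁ * g₁ * a₁⁻¹) * a₂ := by group
      _ = g₂ := by rw [hconj]; group
  · have e₁ : a₁ * g₁ ^ (n₁ + 1) * b₁ = h * (b₁⁻¹ * g₁ * b₁) := by rw [heq₁, pow_succ]; group
    have e₂ : a₂ * g₂ ^ (n₂ + 1) * b₂ = h * (b₂⁻¹ * g₂ * b₂) := by rw [heq₂, pow_succ]; group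
    rw [e₁, e₂] at hlong
    exact mul_left_cancel hlong
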